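/- Let $n\ge 3$ be an integer and write $D=q\frac{d}{dq}$ on $\mathbb{C}[\![q]\!]$. Let $$L=(1-(-n)^nq)^{-1/n}\in 1+q\,\mathbb{C}[\![q]\!],$$ and let $E(q,z)$ be the $I$-function of $K\mathbb{P}^{n-1}$ at $H=1$, with equivariant weights $\chi_i=e^{2\pi\sqrt{-1}\,i/n}$: $$E(q,z)=\sum_{d\ge 0}q^d(-1)^{nd}\,\frac{\prod_{k=0}^{nd-1}(n+kz)}{\prod_{k=1}^{d}\prod_{i=0}^{n-1}(1-\chi_i+kz)},$$ regarded as a power series in $1/z$ with coefficients in $\mathbb{C}[\![q]\!]$. For such a series $F$ with $F(q,\infty)$ invertible in $\mathbb{C}[\![q]\!]$ put $$\mathsf{M}F(q,z)=z\left(\tfrac1z+D\right)\left(\frac{F(q,z)}{F(q,\infty)}\right),$$ and define, for $i\ge 0$, the series $C_i(q)=(\mathsf{M}^iE)(q,\infty)\in 1+q\,\mathbb{C}[\![q]\!]$ and $X_i=\frac{D C_i}{C_i}$, and, for $0\le i\le n$, $$A_i=\frac1L\left(i\,\frac{DL}{L}-\sum_{r=0}^{i}X_r\right)\in\mathbb{C}[\![q]\!].$$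 Let $\mathbb{C}[L^{\pm1}]\subset\mathbb{C}[\![q]\!]$ be the $\mathbb{C}$-subalgebra generated by $L$ and $L^{-1}$, and let $\mathbb{C}[L^{\pm1}][\mathcal{D}\mathcal{A}]\subset\mathbb{C}[\![q]\!]$ be the $\mathbb{C}[L^{\pm1}]$-subalgebra generated by all $D^jA_i$ with $1\le i\le n-1$ and $j\ge 0$. Put $m=\lfloor (n-1)/2\rfloor$ and let $\mathfrak{S}_n$ be the set $$\mathfrak{S}_n=\{D^jA_i : 1\le i\le m-1,\ 0\le j\le n-2-i\}\cup\{A_m\}.$$ Then $\mathfrak{S}_n$ is finite, and $\mathbb{C}[L^{\pm1}][\mathcal{D}\mathcal{A}]$ is a quotient of the free polynomial ring $\mathbb{C}[L^{\pm1}][\mathfrak{S}_n]$ over $\mathbb{C}[L^{\pm1}]$ in variables indexed by the elements of $\mathfrak{S}_n$: there is a surjective homomorphism of $\mathbb{C}[L^{\pm1}]$-algebras $$\mathbb{C}[L^{\pm1}][\mathfrak{S}_n]\longrightarrow\mathbb{C}[L^{\pm1}][\mathcal{D}\mathcal{A}]$$ which sends the variable indexed by each $s\in\mathfrak{S}_n$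 to the series $s$. -/

import Mathlib

namespace LocalProj

open PowerSeries

noncomputable section

/-- The operator `D = q d/dq` on `ℂ⟦q⟧`. -/
def qD (f : ℂ⟦X⟧) : ℂ⟦X⟧ := X * derivative ℂ f

/-- The series `L = (1 - (-n)^n q)^(-1/n)` in `1 + q ℂ⟦q⟧`, by the binomial expansion. -/
def L (n : ℕ) : ℂ⟦X⟧ :=
  rescale (-(-(n : ℂ)) ^ n) (PowerSeries.binomialSeries ℂ (-1 / (n : ℂ)))

/-- The specialized equivariant weights: `chi n i = exp (2 π √-1 i / n)`. -/
def chi (n i : ℕ) : ℂ := Complex.exp (2 * Real.pi * Complex.I / n) ^ i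

/-- The coefficient of `q^d` in the `I`-function of `K ℙ^(n-1)` at `H = 1`, namely
`(-1)^(n d) ∏_{k=0}^{n d - 1} (n + k z) / ∏_{k=1}^{d} ∏_{i=0}^{n-1} (1 - χ_i + k z)`,
written as a power series in `w = 1/z`: numerator and denominator, which have `n d` factors each,
are divided by `z^(n d)`. The denominator is a unit of `ℂ⟦w⟧`. Here `X` stands for `w`. -/
def ICoeff (n d : ℕ) : ℂ⟦X⟧ :=
  (-1) ^ (n * d) * (∏ k ∈ Finset.range (n * d), ((n : ℂ⟦X⟧) * X + (k : ℂ⟦X⟧))) *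
    (∏ k ∈ Finset.Icc 1 d, ∏ i ∈ Finset.range n, (C (1 - chi n i) * X + (k : ℂ⟦X⟧)))⁻¹

/-- Since `∏ (H - χ_i) = H^n - 1`, the denominator of `ICoeff` is `∏_{k=1}^d ((w+k)^n - w^n)`. -/
theorem ICoeff_eq {n : ℕ} (hn : 0 < n) (d : ℕ) :
    ICoeff n d =
      (-1) ^ (n * d) * (∏ k ∈ Finset.range (n * d), ((n : ℂ⟦X⟧) * X + (k : ℂ⟦X⟧))) *
        (∏ k ∈ Finset.Icc 1 d, ((X + (k : ℂ⟦X⟧)) ^ n - X ^ n))⁻¹ := by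
  have hz : IsPrimitiveRoot (C (Complex.exp (2 * Real.pi * Complex.I / n)) : ℂ⟦X⟧) n :=
    (Complex.isPrimitiveRoot_exp n hn.ne').map_of_injective C_injective
  unfold ICoeff
  congr 2
  refine Finset.prod_congr rfl fun k _ => ?_
  rw [hz.pow_sub_pow_eq_prod_sub_mul _ _ hn]
  refine Finset.prod_bij
    (fun i _ => C (Complex.exp (2 * Real.pi * Complex.I / n)) ^ i) ?_ ?_ ?_ ?_
  · intro i _
    rw [Polynomial.mem_nthRootsFinset hn]
    rw [pow_right_comm, hz.pow_eq_one, one_pow]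
  · intro i hi j hj h
    exact hz.pow_inj (Finset.mem_range.1 hi) (Finset.mem_range.1 hj) h
  · intro b hb
    have : NeZero n := ⟨hn.ne'⟩
    obtain ⟨i, hi, h⟩ := hz.eq_pow_of_pow_eq_one ((Polynomial.mem_nthRootsFinset hn _).1 hb)
    exact ⟨i, Finset.mem_range.2 hi, h⟩
  · intro i _
    simp only [chi, map_sub, map_one, map_pow]
    ring

/-- `E(q,z) = I(q,z)|_{H=1}` as a power series in `w = 1/z` (the outer variable) with coefficients
in `ℂ⟦q⟧` (the inner variable). -/
def E (n : ℕ) : ℂ⟦X⟧⟦X⟧ :=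
  PowerSeries.mk fun k => PowerSeries.mk fun d => coeff k (ICoeff n d)

/-- The operator `M F = z (1/z + D) (F(q,z) / F(q,∞))`. With `w = 1/z` and
`G = F(q,w) / F(q,0) = ∑ G_k w^k` this is `(1 + w⁻¹ D) G`, whose coefficient of `w^k` is
`G_k + D G_{k+1}`; there is no term in `w⁻¹`, because `G_0 = 1` and `D 1 = 0`. -/
def M (F : ℂ⟦X⟧⟦X⟧) : ℂ⟦X⟧⟦X⟧ :=
  PowerSeries.mk fun k =>
    (constantCoeff F)⁻¹ * coeff k F + qD ((constantCoeff F)⁻¹ * coeff (k + 1) F)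

/-- `C_i(q) = (M^i E)(q, z = ∞)`. -/
def Cser (n i : ℕ) : ℂ⟦X⟧ := constantCoeff (M^[i] (E n))

/-- `X_i = D C_i / C_i`. -/
def Xser (n i : ℕ) : ℂ⟦X⟧ := qD (Cser n i) * (Cser n i)⁻¹

/-- `A_i = (1/L) (i (D L)/L - ∑_{r=0}^i X_r)`. -/
def A (n i : ℕ) : ℂ⟦X⟧ :=
  (L n)⁻¹ * ((i : ℂ⟦X⟧) * (qD (L n) * (L n)⁻¹) - ∑ r ∈ Finset.range (i + 1), Xser n r)

/-- The ring `ℂ[L^{±1}]`. -/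
def ringL (n : ℕ) : Subalgebra ℂ ℂ⟦X⟧ := Algebra.adjoin ℂ {L n, (L n)⁻¹}

/-- The ring `ℂ[L^{±1}][D A]`, generated over `ℂ[L^{±1}]` by all `D^j A_i`, `1 ≤ i ≤ n-1`,
`j ≥ 0`. -/
def ringDA (n : ℕ) : Subalgebra (ringL n) ℂ⟦X⟧ :=
  Algebra.adjoin (ringL n) {f | ∃ i j : ℕ, 1 ≤ i ∧ i ≤ n - 1 ∧ f = qD^[j] (A n i)}

/-- The set `𝔖_n`: with `m = ⌊(n-1)/2⌋`, the series `D^j A_i` for `1 ≤ i < m`, `0 ≤ j ≤ n-2-i`,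
together with `A_m`. -/
def genS (n : ℕ) : Set ℂ⟦X⟧ :=
  {f | ∃ i j : ℕ, 1 ≤ i ∧ i < (n - 1) / 2 ∧ j ≤ n - 2 - i ∧ f = qD^[j] (A n i)} ∪
    {A n ((n - 1) / 2)}

end

end LocalProj

namespace LocalProj

open PowerSeries

noncomputable section

/-! The Picard–Fuchs operator of `E` is the product (L⁻¹D + A_{n-1})⋯(L⁻¹D + A_0)
(`picardFuchs_eq_miura`), and its coefficients lie in ℂ[L^{±1}], since q = (1 - L^{-n})/(-n)^n. Its
coefficient of D^{n-1-k} is L^{-(n-1)} ∑_i binom(n-1-i, k) D^k A_i modulo the algebra `filt n k` of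
derivatives of order below k. Differentiating these relations and combining binomials, one finds
that ∑_i f(i) D^t A_i lies in `filt n t` for every polynomial f of degree at most t
(`sum_eval_mul_mem`).

Since A_{n-i} = -A_i (`A_symm`), only the part of f odd about n/2 matters. For 1 ≤ i ≤ m, an odd f
of degree at most 2(m-i)+1 vanishes strictly between i and n-i but not at i (`oddPoly`). So for t >
2(m-i) it expresses D^t A_i through D^t A_j with j < i and lower derivatives. By induction on t and
then i, the D^t A_i with t ≤ 2(m-i) generate. They belong to 𝔖_n, as 2(m-i) ≤ n-2-i for i ≥ 1.

Two facts about the C_i feed this. Applied to `E`, `word` with letters C_r⁻¹ yields w^i M^i E, and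
an operator of order below k whose value at `E` is divisible by w^k is zero; this gives the
factorization `picardFuchs_eq`. The operator D∘(Picard–Fuchs) is self-adjoint up to sign, so its
factorization may be reversed; uniqueness of the factors gives C_i = C_{n+1-i} (`Cser_symm`), hence
`A_symm`. -/

/-! ### The derivation `q d/dq` and the series `L` -/

/-- `q d/dq` as a derivation. -/
def qDer : Derivation ℂ ℂ⟦X⟧ ℂ⟦X⟧ := (X : ℂ⟦X⟧) • derivative ℂ

theorem qDer_apply (f : ℂ⟦X⟧) : qDer f = qD f := rfl

theorem qD_add (f g : ℂ⟦X⟧) : qD (f + g) = qD f + qD g := map_add qDer f g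

theorem qD_sub (f g : ℂ⟦X⟧) : qD (f - g) = qD f - qD g := map_sub qDer f g

theorem qD_neg (f : ℂ⟦X⟧) : qD (-f) = -qD f := map_neg qDer f

theorem qD_zero : qD 0 = 0 := map_zero qDer

theorem qD_one : qD 1 = 0 := qDer.map_one_eq_zero

theorem qD_C (a : ℂ) : qD (C a) = 0 := qDer.map_algebraMap a

theorem qD_natCast (a : ℕ) : qD (a : ℂ⟦X⟧) = 0 := qDer.map_natCast a

theorem qD_mul (f g : ℂ⟦X⟧) : qD (f * g) = qD f * g + f * qD g := by
  have := qDer.leibniz f g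
  simp only [qDer_apply, smul_eq_mul] at this
  rw [this]; ring

theorem qD_sum {ι : Type*} (s : Finset ι) (f : ι → ℂ⟦X⟧) :
    qD (∑ i ∈ s, f i) = ∑ i ∈ s, qD (f i) := map_sum qDer f s

theorem qD_X : qD X = X := by simp [qD]

theorem qD_C_mul (a : ℂ) (f : ℂ⟦X⟧) : qD (C a * f) = C a * qD f := by
  rw [qD_mul, qD_C]; ring

theorem coeff_qD (d : ℕ) (f : ℂ⟦X⟧) : coeff d (qD f) = d * coeff d f := by
  cases d with
  | zero => simp [qD]
  | succ d =>
    rw [qD, coeff_succ_X_mul, coeff_derivative]; push_cast; ring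

/-- The elements of the kernel of `q d/dq` are the constants. -/
theorem eq_C_of_qD_eq_zero {f : ℂ⟦X⟧} (h : qD f = 0) : f = C (constantCoeff f) := by
  ext d
  cases d with
  | zero => simp
  | succ d =>
    have := congrArg (coeff (d + 1)) h
    rw [coeff_qD] at this
    have hd : ((d + 1 : ℕ) : ℂ) ≠ 0 := Nat.cast_ne_zero.2 d.succ_ne_zero
    simpa [coeff_C, Nat.cast_add_one_ne_zero] using this

theorem ne_zero_of_constantCoeff_eq_one {f : ℂ⟦X⟧} (h : constantCoeff f = 1) : f ≠ 0 := by
  rintro rfl; simp at h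

theorem mul_inv_of_constantCoeff_eq_one {f : ℂ⟦X⟧} (h : constantCoeff f = 1) : f * f⁻¹ = 1 :=
  PowerSeries.mul_inv_cancel f (by simp [h])

theorem inv_mul_of_constantCoeff_eq_one {f : ℂ⟦X⟧} (h : constantCoeff f = 1) : f⁻¹ * f = 1 :=
  PowerSeries.inv_mul_cancel f (by simp [h])

theorem qD_inv {f : ℂ⟦X⟧} (h : constantCoeff f = 1) : qD f⁻¹ = -(qD f * f⁻¹ * f⁻¹) := by
  have h1 := mul_inv_of_constantCoeff_eq_one h
  have h2 := congrArg qD h1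
  rw [qD_mul, qD_one] at h2
  linear_combination f⁻¹ * h2 - qD f⁻¹ * h1

theorem L_pow_mul {n : ℕ} (hn : 0 < n) : L n ^ n * (1 - C ((-(n : ℂ)) ^ n) * X) = 1 := by
  have hn' : (n : ℂ) ≠ 0 := Nat.cast_ne_zero.2 hn.ne'
  have hp : ∀ k : ℕ, (PowerSeries.binomialSeries ℂ (-1 / (n : ℂ)) : ℂ⟦X⟧) ^ k =
      PowerSeries.binomialSeries ℂ ((k : ℂ) * (-1 / (n : ℂ))) := by
    intro k
    induction k with
    | zero => simp
    | succ k ih =>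
      rw [pow_succ, ih, ← binomialSeries_add]; congr 1; push_cast; ring
  have h1 : (PowerSeries.binomialSeries ℂ (-1 / (n : ℂ)) : ℂ⟦X⟧) ^ n * (1 + X) = 1 := by
    have : (1 + X : ℂ⟦X⟧) = PowerSeries.binomialSeries ℂ (1 : ℂ) := by
      have := binomialSeries_nat (R := ℂ) (A := ℂ) 1
      rw [pow_one, Nat.cast_one] at this
      exact this.symm
    rw [hp, this, ← binomialSeries_add]
    have h0 : (n : ℂ) * (-1 / (n : ℂ)) + 1 = 0 := by field_simp; ring
    rw [h0]; simp
  have h2 := congrArg (rescale (-(-(n : ℂ)) ^ n)) h1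
  rw [map_mul, map_pow, map_add, map_one, rescale_X] at h2
  refine Eq.trans ?_ h2
  rw [L, map_neg]; ring

theorem constantCoeff_L (n : ℕ) : constantCoeff (L n) = 1 := by
  rw [L, ← coeff_zero_eq_constantCoeff_apply, coeff_rescale]
  simp

theorem L_mul_inv (n : ℕ) : L n * (L n)⁻¹ = 1 :=
  mul_inv_of_constantCoeff_eq_one (constantCoeff_L n)

/-- The differential equation `D L = L (L^n - 1) / n`. -/
theorem qD_L {n : ℕ} (hn : 0 < n) : (n : ℂ⟦X⟧) * qD (L n) = L n * (L n ^ n - 1) := by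
  have h1 := L_pow_mul hn
  have h2 := congrArg qD h1
  have h3 : qD (L n ^ n) = n * L n ^ (n - 1) * qD (L n) := by
    have := qDer.leibniz_pow (L n) n
    rw [qDer_apply, qDer_apply] at this
    rw [this, smul_eq_mul, nsmul_eq_mul, mul_assoc]
  have h4 : L n ^ n = L n * L n ^ (n - 1) := by
    rw [← pow_succ']; congr 1; omega
  rw [qD_mul, qD_sub, qD_C_mul, qD_X, qD_one, h3] at h2
  linear_combination L n * h2 - (n * qD (L n) + L n) * h1 +
    n * qD (L n) * (1 - C ((-(n : ℂ)) ^ n) * X) * h4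

/-! ### Differential operators as polynomials in `D` -/

/-- The coefficientwise action of `q d/dq` on polynomials. -/
def coeffD (p : Polynomial ℂ⟦X⟧) : Polynomial ℂ⟦X⟧ :=
  ∑ j ∈ p.support, Polynomial.monomial j (qD (p.coeff j))

theorem coeff_coeffD (p : Polynomial ℂ⟦X⟧) (j : ℕ) : (coeffD p).coeff j = qD (p.coeff j) := by
  simp only [coeffD, Polynomial.finsetSum_coeff, Polynomial.coeff_monomial]
  rw [Finset.sum_ite_eq' p.support j]
  split_ifs with h
  · rfl
  · rw [Polynomial.notMem_support_iff.1 h, qD_zero]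

/-- Composition with `D` from the left, on total symbols of differential operators. -/
def leftD (p : Polynomial ℂ⟦X⟧) : Polynomial ℂ⟦X⟧ := p * Polynomial.X + coeffD p

theorem coeff_leftD_zero (p : Polynomial ℂ⟦X⟧) : (leftD p).coeff 0 = qD (p.coeff 0) := by
  simp [leftD, coeff_coeffD]

theorem coeff_leftD_succ (p : Polynomial ℂ⟦X⟧) (j : ℕ) :
    (leftD p).coeff (j + 1) = p.coeff j + qD (p.coeff (j + 1)) := by
  simp [leftD, coeff_coeffD]

theorem leftD_add (p r : Polynomial ℂ⟦X⟧) : leftD (p + r) = leftD p + leftD r := by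
  ext1 j
  cases j <;> simp [coeff_leftD_zero, coeff_leftD_succ, qD_add]; ring

theorem leftD_sub (p r : Polynomial ℂ⟦X⟧) : leftD (p - r) = leftD p - leftD r := by
  ext1 j
  cases j <;> simp [coeff_leftD_zero, coeff_leftD_succ, qD_sub]; ring

theorem leftD_C_mul (a : ℂ⟦X⟧) (p : Polynomial ℂ⟦X⟧) :
    leftD (Polynomial.C a * p) = Polynomial.C (qD a) * p + Polynomial.C a * leftD p := by
  ext1 j
  cases j <;> simp [coeff_leftD_zero, coeff_leftD_succ, qD_mul]; ring

theorem leftD_map (p : Polynomial ℂ) : leftD (p.map C) = p.map C * Polynomial.X := by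
  ext1 j
  cases j <;> simp [coeff_leftD_zero, coeff_leftD_succ, qD_C]

section Action

variable {S : Type*} [CommRing S] (φ : ℂ⟦X⟧ →+* S) (T : AddMonoid.End S)

/-- The action of a differential operator, functions acting through `φ` and `D` acting by `T`. -/
def act (p : Polynomial ℂ⟦X⟧) (v : S) : S := p.sum fun j a => φ a * (T ^ j) v

theorem act_add (p r : Polynomial ℂ⟦X⟧) (v : S) : act φ T (p + r) v = act φ T p v + act φ T r v :=
  Polynomial.sum_add_index _ _ _ (by simp) (by simp [add_mul])

theorem act_monomial (j : ℕ) (a : ℂ⟦X⟧) (v : S) :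
    act φ T (Polynomial.monomial j a) v = φ a * (T ^ j) v :=
  Polynomial.sum_monomial_index _ _ (by simp)

theorem act_C_mul (a : ℂ⟦X⟧) (p : Polynomial ℂ⟦X⟧) (v : S) :
    act φ T (Polynomial.C a * p) v = φ a * act φ T p v := by
  induction p using Polynomial.induction_on' with
  | add p r hp hr => rw [mul_add, act_add, act_add, hp, hr, mul_add]
  | monomial j b =>
    rw [Polynomial.C_mul_monomial, act_monomial, act_monomial, map_mul, mul_assoc]

theorem act_zero (v : S) : act φ T 0 v = 0 := by simp [act]

theorem act_one (v : S) : act φ T 1 v = v := by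
  rw [← Polynomial.C_1, ← Polynomial.monomial_zero_left, act_monomial]; simp

theorem act_sub (p r : Polynomial ℂ⟦X⟧) (v : S) :
    act φ T (p - r) v = act φ T p v - act φ T r v := by
  rw [eq_sub_iff_add_eq, ← act_add, sub_add_cancel]

/-- Polynomial multiplication is not composition of operators. Coefficients stand to the left of D,
and the product rule `hT` accounts for moving D past them. -/
theorem act_leftD (hT : ∀ (a : ℂ⟦X⟧) (v : S), T (φ a * v) = φ (qD a) * v + φ a * T v)
    (p : Polynomial ℂ⟦X⟧) (v : S) : act φ T (leftD p) v = T (act φ T p v) := by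
  induction p using Polynomial.induction_on' with
  | add p r hp hr => rw [leftD_add, act_add, act_add, hp, hr, map_add]
  | monomial j b =>
    have : leftD (Polynomial.monomial j b) =
        Polynomial.monomial j (qD b) + Polynomial.monomial (j + 1) b := by
      rw [← Polynomial.C_mul_X_pow_eq_monomial, leftD_C_mul]
      have := leftD_map (Polynomial.X ^ j)
      rw [Polynomial.map_pow, Polynomial.map_X] at this
      rw [this, ← pow_succ, Polynomial.C_mul_X_pow_eq_monomial, Polynomial.C_mul_X_pow_eq_monomial]
    rw [this, act_add, act_monomial, act_monomial, act_monomial, hT, pow_succ']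
    rfl

end Action

/-! ### The operators `D + w` and `D + s` -/

/-- The operator `D + w` on power series in `w` over `ℂ⟦q⟧`. -/
def opW : AddMonoid.End ℂ⟦X⟧⟦X⟧ where
  toFun F := PowerSeries.mk (fun k => qD (coeff k F)) + X * F
  map_zero' := by ext1 k; simp [qD_zero]
  map_add' F G := by
    ext1 k
    simp [qD_add, mul_add]; ring

theorem opW_apply (F : ℂ⟦X⟧⟦X⟧) : opW F = PowerSeries.mk (fun k => qD (coeff k F)) + X * F := rfl

theorem coeff_zero_opW (F : ℂ⟦X⟧⟦X⟧) : coeff 0 (opW F) = qD (coeff 0 F) := by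
  simp [opW_apply]

theorem coeff_succ_opW (F : ℂ⟦X⟧⟦X⟧) (k : ℕ) :
    coeff (k + 1) (opW F) = qD (coeff (k + 1) F) + coeff k F := by
  simp [opW_apply, coeff_succ_X_mul]

theorem opW_C_mul (a : ℂ⟦X⟧) (F : ℂ⟦X⟧⟦X⟧) : opW (C a * F) = C (qD a) * F + C a * opW F := by
  ext1 k
  cases k with
  | zero => rw [coeff_zero_opW, map_add, coeff_C_mul, coeff_C_mul, coeff_C_mul, coeff_zero_opW, qD_mul]
  | succ k =>
    rw [coeff_succ_opW, map_add, coeff_C_mul, coeff_C_mul, coeff_C_mul, coeff_C_mul, coeff_succ_opW,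
      qD_mul]
    ring

theorem opW_X_pow_mul (F : ℂ⟦X⟧⟦X⟧) (i : ℕ) : opW (X ^ i * F) = X ^ i * opW F := by
  rw [opW_apply, opW_apply, mul_add]
  congr 1
  · ext1 k
    rw [coeff_mk, coeff_X_pow_mul', coeff_X_pow_mul']
    split_ifs
    · rw [coeff_mk]
    · exact qD_zero
  · ring

/-- The coefficient of `q^d`, a power series in `w`. -/
def row (d : ℕ) (F : ℂ⟦X⟧⟦X⟧) : ℂ⟦X⟧ := PowerSeries.mk fun k => coeff d (coeff k F)

theorem row_ext {F G : ℂ⟦X⟧⟦X⟧} (h : ∀ d, row d F = row d G) : F = G := by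
  ext k d
  simpa [row] using congrArg (coeff k) (h d)

theorem row_add (d : ℕ) (F G : ℂ⟦X⟧⟦X⟧) : row d (F + G) = row d F + row d G := by
  ext k; simp [row]

theorem row_sub (d : ℕ) (F G : ℂ⟦X⟧⟦X⟧) : row d (F - G) = row d F - row d G := by
  ext k; simp [row]

theorem row_X_pow_mul (d i : ℕ) (F : ℂ⟦X⟧⟦X⟧) : row d (X ^ i * F) = X ^ i * row d F := by
  ext k
  simp only [row, coeff_mk, coeff_X_pow_mul']
  split_ifs <;> simp

theorem row_opW (d : ℕ) (F : ℂ⟦X⟧⟦X⟧) : row d (opW F) = (C (d : ℂ) + X) * row d F := by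
  ext k
  cases k with
  | zero =>
    rw [row, row, coeff_mk, coeff_zero_opW, coeff_qD, add_mul, map_add, coeff_C_mul, coeff_mk,
      coeff_zero_X_mul, add_zero]
  | succ k =>
    rw [row, row, coeff_mk, coeff_succ_opW, map_add, coeff_qD, add_mul, map_add, coeff_C_mul,
      coeff_mk, coeff_succ_X_mul, coeff_mk]

theorem row_C_C_mul (d : ℕ) (a : ℂ) (F : ℂ⟦X⟧⟦X⟧) :
    row d (C (C a) * F) = C a * row d F := by
  ext k; simp [row]

theorem row_zero_C_mul (a : ℂ⟦X⟧) (F : ℂ⟦X⟧⟦X⟧) :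
    row 0 (C a * F) = C (constantCoeff a) * row 0 F := by
  ext k; simp [row]

theorem row_zero_C_X_mul (F : ℂ⟦X⟧⟦X⟧) : row 0 (C X * F) = 0 := by
  simp [row_zero_C_mul]

theorem row_succ_C_X_mul (d : ℕ) (F : ℂ⟦X⟧⟦X⟧) : row (d + 1) (C X * F) = row d F := by
  ext k; simp [row, coeff_succ_X_mul, coeff_C_mul]

/-- On the coefficient of q^d, the operator D + w is multiplication by d + w. -/
theorem row_act_map (d : ℕ) (p : Polynomial ℂ) (F : ℂ⟦X⟧⟦X⟧) :
    row d (act C opW (p.map C) F) = Polynomial.aeval (C (d : ℂ) + X : ℂ⟦X⟧) p * row d F := by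
  induction p using Polynomial.induction_on' with
  | add p r hp hr => rw [Polynomial.map_add, act_add, row_add, hp, hr, map_add, add_mul]
  | monomial j b =>
    have h : ∀ j, row d ((opW ^ j) F) = (C (d : ℂ) + X) ^ j * row d F := by
      intro j
      induction j with
      | zero => simp
      | succ j ih => rw [pow_succ', AddMonoid.End.coe_mul, Function.comp_apply, row_opW, ih]; ring
    rw [Polynomial.map_monomial, act_monomial, row_C_C_mul, h, Polynomial.aeval_monomial]
    rw [mul_assoc]; rfl

/-- The operator `D + s` on `ℂ⟦q⟧`. -/
def opS (s : ℂ) : AddMonoid.End ℂ⟦X⟧ where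
  toFun f := qD f + C s * f
  map_zero' := by simp [qD_zero]
  map_add' f g := by rw [qD_add]; ring

theorem opS_apply (s : ℂ) (f : ℂ⟦X⟧) : opS s f = qD f + C s * f := rfl

theorem opS_mul (s : ℂ) (a f : ℂ⟦X⟧) :
    opS s (RingHom.id _ a * f) = RingHom.id _ (qD a) * f + RingHom.id _ a * opS s f := by
  simp only [opS_apply, RingHom.id_apply, qD_mul]; ring

theorem coeff_opS (s : ℂ) (d : ℕ) (f : ℂ⟦X⟧) : coeff d (opS s f) = (d + s) * coeff d f := by
  rw [opS_apply, map_add, coeff_qD, coeff_C_mul]; ring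

theorem coeff_act_opS_map (s : ℂ) (d : ℕ) (p : Polynomial ℂ) (f : ℂ⟦X⟧) :
    coeff d (act (RingHom.id _) (opS s) (p.map C) f) = p.eval (d + s) * coeff d f := by
  induction p using Polynomial.induction_on' with
  | add p r hp hr => rw [Polynomial.map_add, act_add, map_add, hp, hr, Polynomial.eval_add, add_mul]
  | monomial j b =>
    have h : ∀ j, coeff d ((opS s ^ j) f) = (d + s) ^ j * coeff d f := by
      intro j
      induction j with
      | zero => simp
      | succ j ih => rw [pow_succ', AddMonoid.End.coe_mul, Function.comp_apply, coeff_opS, ih]; ring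
    rw [Polynomial.map_monomial, act_monomial, RingHom.id_apply, coeff_C_mul, h,
      Polynomial.eval_monomial, mul_assoc]

/-! ### The Picard–Fuchs equation -/

/-- The polynomial `∏_{k < m} (n x + k)`. -/
def risingProd (n m : ℕ) : Polynomial ℂ :=
  ∏ k ∈ Finset.range m, (Polynomial.C (n : ℂ) * Polynomial.X + Polynomial.C (k : ℂ))

/-- The Picard–Fuchs operator `D^n - (-1)^n q ∏_{k < n} (n D + k)`. -/
def picardFuchs (n : ℕ) : Polynomial ℂ⟦X⟧ :=
  (Polynomial.X ^ n : Polynomial ℂ).map C -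
    Polynomial.C (C ((-1) ^ n)) * (Polynomial.C X * (risingProd n n).map C)

theorem row_E (n d : ℕ) : row d (E n) = ICoeff n d := by
  ext k; simp [row, E]

theorem ICoeff_zero (n : ℕ) : ICoeff n 0 = 1 := by simp [ICoeff]

/-- The new numerator factors are n(d + w) + k with k < n; the new denominator factor is (w + d +
1)^n - w^n. Its term -w^n becomes the right side of `act_picardFuchs_E`. -/
theorem ICoeff_succ {n : ℕ} (hn : 0 < n) (d : ℕ) :
    ((X + ((d + 1 : ℕ) : ℂ⟦X⟧)) ^ n - X ^ n) * ICoeff n (d + 1) =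
      (-1) ^ n * Polynomial.aeval (C (d : ℂ) + X : ℂ⟦X⟧) (risingProd n n) * ICoeff n d := by
  have hc : constantCoeff ((X + ((d + 1 : ℕ) : ℂ⟦X⟧)) ^ n - X ^ n) ≠ 0 := by
    rw [map_sub, map_pow, map_pow, map_add, constantCoeff_X, zero_pow hn.ne', map_natCast, zero_add,
      sub_zero]
    exact pow_ne_zero _ (Nat.cast_ne_zero.2 d.succ_ne_zero)
  have h1 := PowerSeries.mul_inv_cancel _ hc
  have h2 : Polynomial.aeval (C (d : ℂ) + X : ℂ⟦X⟧) (risingProd n n) =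
      ∏ k ∈ Finset.range n, ((n : ℂ⟦X⟧) * X + ((n * d + k : ℕ) : ℂ⟦X⟧)) := by
    rw [risingProd, map_prod]
    refine Finset.prod_congr rfl fun k _ => ?_
    simp only [map_add, map_mul, Polynomial.aeval_X, map_natCast]
    push_cast; ring
  rw [ICoeff_eq hn, ICoeff_eq hn, h2, Finset.prod_Icc_succ_top (by omega), PowerSeries.mul_inv_rev,
    mul_add_one n d, Finset.prod_range_add, pow_add]
  linear_combination ((-1) ^ (n * d) * (-1) ^ n *
    ((∏ k ∈ Finset.range (n * d), ((n : ℂ⟦X⟧) * X + (k : ℂ⟦X⟧))) *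
      ∏ k ∈ Finset.range n, ((n : ℂ⟦X⟧) * X + ((n * d + k : ℕ) : ℂ⟦X⟧))) *
    (∏ k ∈ Finset.Icc 1 d, ((X + (k : ℂ⟦X⟧)) ^ n - X ^ n))⁻¹) * h1

theorem act_picardFuchs_E {n : ℕ} (hn : 0 < n) : act C opW (picardFuchs n) (E n) = X ^ n * E n := by
  refine row_ext fun d => ?_
  rw [picardFuchs, act_sub, act_C_mul, act_C_mul, row_sub, row_act_map, row_C_C_mul, row_X_pow_mul]
  cases d with
  | zero => rw [row_zero_C_X_mul]; simp
  | succ d =>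
    rw [row_succ_C_X_mul, row_act_map, row_E, row_E]
    have := ICoeff_succ hn d
    simp only [map_pow, Polynomial.aeval_X, map_neg, map_one, map_natCast] at this ⊢
    linear_combination this

/-! ### The Birkhoff factorization -/

/-- The operator `D c_{i-1} D c_{i-2} ⋯ D c_0`. -/
def word (c : ℕ → ℂ⟦X⟧) : ℕ → Polynomial ℂ⟦X⟧
  | 0 => 1
  | i + 1 => leftD (Polynomial.C (c i) * word c i)

theorem act_word_succ {S : Type*} [CommRing S] {φ : ℂ⟦X⟧ →+* S} {T : AddMonoid.End S}
    (hT : ∀ (a : ℂ⟦X⟧) (v : S), T (φ a * v) = φ (qD a) * v + φ a * T v) (c : ℕ → ℂ⟦X⟧) (i : ℕ)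
    (v : S) : act φ T (word c (i + 1)) v = T (φ (c i) * act φ T (word c i) v) := by
  rw [word, act_leftD φ T hT, act_C_mul]

theorem X_mul_M (F : ℂ⟦X⟧⟦X⟧) (h : constantCoeff (constantCoeff F) = 1) :
    X * M F = opW (C (constantCoeff F)⁻¹ * F) := by
  ext1 k
  cases k with
  | zero =>
    rw [coeff_zero_opW, coeff_C_mul, coeff_zero_eq_constantCoeff_apply,
      coeff_zero_eq_constantCoeff_apply, inv_mul_of_constantCoeff_eq_one h, qD_one]
    simp
  | succ k =>
    rw [coeff_succ_X_mul, coeff_succ_opW, M, coeff_mk, coeff_C_mul,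
      coeff_C_mul, add_comm]

/-- Modulo q the operator D vanishes, so the value 1 of `E` at q = 0 persists. Hence every C_i is
invertible. -/
theorem row_zero_iterate_M (n i : ℕ) : row 0 (M^[i] (E n)) = 1 := by
  induction i with
  | zero => rw [Function.iterate_zero_apply, row_E, ICoeff_zero]
  | succ i ih =>
    rw [Function.iterate_succ_apply']
    have hc : constantCoeff (constantCoeff (M^[i] (E n))) = 1 := by
      simpa [row] using congrArg constantCoeff ih
    have := congrArg (row 0) (X_mul_M _ hc)
    rw [row_opW, row_zero_C_mul, ih, ← pow_one X, row_X_pow_mul, constantCoeff_inv, hc] at this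
    simpa using this

theorem constantCoeff_Cser (n i : ℕ) : constantCoeff (Cser n i) = 1 := by
  simpa [row, Cser] using congrArg constantCoeff (row_zero_iterate_M n i)

theorem act_word_E (n i : ℕ) :
    act C opW (word (fun r => (Cser n r)⁻¹) i) (E n) = X ^ i * M^[i] (E n) := by
  induction i with
  | zero => simp [word, act_one]
  | succ i ih =>
    rw [act_word_succ opW_C_mul, ih, Function.iterate_succ_apply', pow_succ, mul_assoc,
      X_mul_M _ (constantCoeff_Cser n i), ← opW_X_pow_mul, mul_left_comm, Cser]

theorem coeff_word_of_lt (c : ℕ → ℂ⟦X⟧) {i j : ℕ} (h : i < j) : (word c i).coeff j = 0 := by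
  induction i generalizing j with
  | zero => rw [word, Polynomial.coeff_one, if_neg (by omega)]
  | succ i ih =>
    obtain ⟨j, rfl⟩ : ∃ k, j = k + 1 := ⟨j - 1, by omega⟩
    rw [word, coeff_leftD_succ, Polynomial.coeff_C_mul, Polynomial.coeff_C_mul, ih (by omega),
      ih (by omega)]
    simp [qD_zero]

theorem coeff_word_self (c : ℕ → ℂ⟦X⟧) (i : ℕ) :
    (word c i).coeff i = ∏ r ∈ Finset.range i, c r := by
  induction i with
  | zero => simp [word]
  | succ i ih =>
    rw [word, coeff_leftD_succ, Polynomial.coeff_C_mul, Polynomial.coeff_C_mul, ih,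
      coeff_word_of_lt c (Nat.lt_succ_self i), Finset.prod_range_succ]
    simp [qD_zero, mul_comm]

theorem Cser_mul_inv (n i : ℕ) : Cser n i * (Cser n i)⁻¹ = 1 :=
  mul_inv_of_constantCoeff_eq_one (constantCoeff_Cser n i)

theorem Cser_ne_zero (n i : ℕ) : Cser n i ≠ 0 :=
  ne_zero_of_constantCoeff_eq_one (constantCoeff_Cser n i)

/-- An operator of order less than `k` whose value at `E` is divisible by `w^k` vanishes. -/
theorem eq_zero_of_X_pow_dvd_act (n k : ℕ) (p : Polynomial ℂ⟦X⟧) (hp : ∀ j, k ≤ j → p.coeff j = 0)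
    (h : (X : ℂ⟦X⟧⟦X⟧) ^ k ∣ act C opW p (E n)) : p = 0 := by
  induction k generalizing p with
  | zero => ext1 j; simpa using hp j (Nat.zero_le j)
  | succ k ih =>
    set c : ℕ → ℂ⟦X⟧ := fun r => (Cser n r)⁻¹ with hc
    -- The quotient of the coefficients of D^k in `p` and in the word, so that the difference has
    -- order below k.
    set a : ℂ⟦X⟧ := p.coeff k * ∏ r ∈ Finset.range k, Cser n r with ha
    have hE : act C opW (word c k) (E n) = X ^ k * M^[k] (E n) := act_word_E n k
    have h0 : p - Polynomial.C a * word c k = 0 := by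
      refine ih _ (fun j hj => ?_) ?_
      · rw [Polynomial.coeff_sub, Polynomial.coeff_C_mul]
        rcases hj.eq_or_lt with rfl | hj
        · rw [coeff_word_self, ha, mul_assoc, ← Finset.prod_mul_distrib]
          simp [hc, Cser_mul_inv]
        · rw [hp j hj, coeff_word_of_lt c hj]; simp
      · rw [act_sub, act_C_mul, hE]
        exact dvd_sub ((pow_dvd_pow X k.le_succ).trans h) ((dvd_mul_right _ _).mul_left _)
    rw [sub_eq_zero] at h0
    rw [h0, act_C_mul, hE, mul_left_comm, pow_succ,
      mul_dvd_mul_iff_left (pow_ne_zero _ X_ne_zero), X_dvd_iff, map_mul, constantCoeff_C] at h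
    have : a = 0 := (mul_eq_zero.1 h).resolve_right (Cser_ne_zero n k)
    rw [h0, this]; simp

theorem coeff_risingProd (n : ℕ) : (risingProd n n).coeff n = (n : ℂ) ^ n := by
  have := Polynomial.coeff_prod_of_natDegree_le (s := Finset.range n)
    (fun k : ℕ => (Polynomial.C (n : ℂ) * Polynomial.X + Polynomial.C (k : ℂ))) 1
    (fun k _ => Polynomial.natDegree_linear_le)
  rw [Finset.card_range, mul_one] at this
  rw [risingProd, this]
  simp

theorem coeff_risingProd_of_lt {n j : ℕ} (h : n < j) : (risingProd n n).coeff j = 0 := by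
  refine Polynomial.coeff_eq_zero_of_natDegree_lt (lt_of_le_of_lt ?_ h)
  refine (Polynomial.natDegree_prod_le _ _).trans ?_
  refine (Finset.sum_le_card_nsmul _ _ 1 fun k _ => Polynomial.natDegree_linear_le).trans ?_
  simp

theorem coeff_picardFuchs_of_lt {n j : ℕ} (h : n < j) : (picardFuchs n).coeff j = 0 := by
  rw [picardFuchs, Polynomial.coeff_sub, Polynomial.coeff_C_mul, Polynomial.coeff_C_mul,
    Polynomial.coeff_map, Polynomial.coeff_map, coeff_risingProd_of_lt h, Polynomial.coeff_X_pow,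
    if_neg h.ne']
  simp

theorem coeff_picardFuchs_self (n : ℕ) :
    (picardFuchs n).coeff n = 1 - C ((-(n : ℂ)) ^ n) * X := by
  rw [picardFuchs, Polynomial.coeff_sub, Polynomial.coeff_C_mul, Polynomial.coeff_C_mul,
    Polynomial.coeff_map, Polynomial.coeff_map, coeff_risingProd, Polynomial.coeff_X_pow_self,
    neg_pow (n : ℂ), map_mul, map_one]
  ring

/-- For d ≥ 1 the numerator contains the factor k = 0, namely n w, which vanishes at w = 0. -/
theorem Cser_zero {n : ℕ} (hn : 0 < n) : Cser n 0 = 1 := by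
  ext d
  have : coeff d (Cser n 0) = constantCoeff (ICoeff n d) := by
    rw [← row_E, Cser, Function.iterate_zero_apply]; simp [row]
  rw [this]
  cases d with
  | zero => simp [ICoeff_zero]
  | succ d =>
    rw [ICoeff, mul_add_one, Nat.add_comm, Finset.prod_range_add]
    have h0 : constantCoeff (∏ k ∈ Finset.range n, ((n : ℂ⟦X⟧) * X + (k : ℂ⟦X⟧))) = 0 := by
      rw [map_prod]
      exact Finset.prod_eq_zero (Finset.mem_range.2 hn) (by simp)
    simp only [map_mul, h0]
    simp [coeff_one]

/-- Both operators have order n and send `E` to a multiple of w^n. With leading coefficients matched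
by `g`, their difference vanishes; what remains is E = g M^n E, whose value at w = 0 is 1 = g C_n.
-/
theorem picardFuchs_eq_and_prod {n : ℕ} (hn : 0 < n) :
    picardFuchs n = Polynomial.C (Cser n n)⁻¹ * word (fun r => (Cser n r)⁻¹) n ∧
      (1 - C ((-(n : ℂ)) ^ n) * X) * ∏ r ∈ Finset.range (n + 1), Cser n r = 1 := by
  set c : ℕ → ℂ⟦X⟧ := fun r => (Cser n r)⁻¹ with hc
  set g : ℂ⟦X⟧ := (1 - C ((-(n : ℂ)) ^ n) * X) * ∏ r ∈ Finset.range n, Cser n r with hg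
  have hE : act C opW (word c n) (E n) = X ^ n * M^[n] (E n) := act_word_E n n
  have hact : act C opW (picardFuchs n - Polynomial.C g * word c n) (E n) =
      X ^ n * (E n - C g * M^[n] (E n)) := by
    rw [act_sub, act_C_mul, hE, act_picardFuchs_E hn]; ring
  have h0 : picardFuchs n - Polynomial.C g * word c n = 0 := by
    refine eq_zero_of_X_pow_dvd_act n n _ (fun j hj => ?_) (hact ▸ dvd_mul_right _ _)
    rw [Polynomial.coeff_sub, Polynomial.coeff_C_mul]
    rcases hj.eq_or_lt with rfl | hj
    · rw [coeff_word_self, hg, mul_assoc, ← Finset.prod_mul_distrib, coeff_picardFuchs_self]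
      simp [hc, Cser_mul_inv]
    · rw [coeff_picardFuchs_of_lt hj, coeff_word_of_lt c hj]; simp
  rw [h0, act_zero, eq_comm, mul_eq_zero, or_iff_right (pow_ne_zero _ X_ne_zero), sub_eq_zero]
    at hact
  have h1 : g * Cser n n = 1 := by
    have := congrArg constantCoeff hact
    rw [map_mul, constantCoeff_C] at this
    rw [Cser, ← this]
    exact Cser_zero hn
  have h2 : g = (Cser n n)⁻¹ := by
    linear_combination (Cser n n)⁻¹ * h1 - g * Cser_mul_inv n n
  refine ⟨?_, ?_⟩
  · rw [← h2]; exact sub_eq_zero.1 h0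
  · rw [Finset.prod_range_succ, ← mul_assoc]; exact h1

/-- The factorization `D^n - (-1)^n q ∏ (n D + k) = C_n⁻¹ D C_{n-1}⁻¹ D ⋯ C_1⁻¹ D`. -/
theorem picardFuchs_eq {n : ℕ} (hn : 0 < n) :
    picardFuchs n = Polynomial.C (Cser n n)⁻¹ * word (fun r => (Cser n r)⁻¹) n :=
  (picardFuchs_eq_and_prod hn).1

theorem prod_Cser {n : ℕ} (hn : 0 < n) : ∏ r ∈ Finset.range (n + 1), Cser n r = L n ^ n := by
  linear_combination (L n ^ n) * (picardFuchs_eq_and_prod hn).2 -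
    (∏ r ∈ Finset.range (n + 1), Cser n r) * L_pow_mul hn

/-! ### Self-adjointness and the symmetry of the `C_i` -/

/-- Integration by parts for the pairing (f, g) ↦ coefficient of q^N in fg: that coefficient of (D -
N)(fg) is zero. -/
theorem coeff_opS_mul (N : ℕ) (f g : ℂ⟦X⟧) :
    coeff N (opS (-N) f * g) = -coeff N (f * opS 0 g) := by
  have h := coeff_qD N (f * g)
  rw [qD_mul, map_add] at h
  have h1 : opS (-N) f * g = qD f * g - C (N : ℂ) * (f * g) := by
    rw [opS_apply, map_neg]; ring
  have h2 : f * opS 0 g = f * qD g := by rw [opS_apply, map_zero]; ring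
  rw [h1, h2, map_sub, coeff_C_mul]
  linear_combination h

/-- Each letter D is moved across the pairing in turn, at the cost of a sign, which reverses the
order of the c's. -/
theorem coeff_act_word_mul (N n : ℕ) (c c' : ℕ → ℂ⟦X⟧) (hc : c 0 = 1) (hc' : c' 0 = 1)
    (h : ∀ j ≤ n, c' (j + 1) = c (n - j)) (f g : ℂ⟦X⟧) :
    coeff N (act (RingHom.id _) (opS (-N)) (word c (n + 1)) f * g) =
      (-1) ^ (n + 1) * coeff N (f * act (RingHom.id _) (opS 0) (word c' (n + 1)) g) := by
  have key : ∀ j ≤ n + 1, coeff N (act (RingHom.id _) (opS (-N)) (word c (n + 1)) f * g) =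
      (-1) ^ j * coeff N (act (RingHom.id _) (opS (-N)) (word c (n + 1 - j)) f *
        (c' j * act (RingHom.id _) (opS 0) (word c' j) g)) := by
    intro j hj
    induction j with
    | zero => simp [word, act_one, hc']
    | succ j ih =>
      rw [ih (by omega), show n + 1 - j = (n - j) + 1 by omega, Nat.add_sub_add_right,
        act_word_succ (opS_mul _), coeff_opS_mul, act_word_succ (opS_mul _), h j (by omega),
        pow_succ, RingHom.id_apply, RingHom.id_apply]
      rw [mul_neg, mul_neg_one, neg_mul]
      congr 3
      ring
  rw [key (n + 1) le_rfl, Nat.sub_self, h n le_rfl, Nat.sub_self, hc, one_mul]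
  simp [word, act_one]

theorem coeff_act_map_mul (N : ℕ) (s : ℂ) (p r : Polynomial ℂ)
    (hpr : ∀ b : ℂ, p.eval (N + s - b) = r.eval b) (f g : ℂ⟦X⟧) :
    coeff N (act (RingHom.id _) (opS s) (p.map C) f * g) =
      coeff N (f * act (RingHom.id _) (opS 0) (r.map C) g) := by
  rw [coeff_mul, coeff_mul]
  refine Finset.sum_congr rfl fun x hx => ?_
  have hx' : (x.1 : ℂ) + x.2 = N := by
    exact_mod_cast congrArg (Nat.cast (R := ℂ)) (Finset.HasAntidiagonal.mem_antidiagonal.1 hx)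
  rw [coeff_act_opS_map, coeff_act_opS_map, add_zero, ← hpr, ← hx']
  rw [show (x.1 : ℂ) + x.2 + s - x.2 = x.1 + s by ring]
  ring

/-- The polynomial `(x + 1) ∏_{k < n} (n x + k)`. -/
def shiftedProd (n : ℕ) : Polynomial ℂ := (Polynomial.X + 1) * risingProd n n

theorem leftD_picardFuchs (n : ℕ) :
    leftD (picardFuchs n) = (Polynomial.X ^ (n + 1) : Polynomial ℂ).map C -
      Polynomial.C (C ((-1) ^ n)) * (Polynomial.C X * (shiftedProd n).map C) := by
  rw [picardFuchs, leftD_sub, leftD_map, leftD_C_mul, leftD_C_mul, leftD_map, qD_C, qD_X,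
    shiftedProd, Polynomial.map_mul, Polynomial.map_add, Polynomial.map_X, Polynomial.map_one,
    Polynomial.map_pow, Polynomial.map_X, Polynomial.map_pow, Polynomial.map_X, map_zero]
  ring

/-- The n + 1 roots 0, -1/n, …, -1 are symmetric about -1/2. The root -1 comes from the extra D
composed on the left. -/
theorem eval_shiftedProd {n : ℕ} (hn : 0 < n) (b : ℂ) :
    (shiftedProd n).eval (-1 - b) = (-1) ^ (n + 1) * (shiftedProd n).eval b := by
  have h : ∀ x : ℂ, (n : ℂ) * (shiftedProd n).eval x = ∏ k ∈ Finset.range (n + 1), (n * x + k) := by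
    intro x
    rw [shiftedProd, risingProd, Polynomial.eval_mul, Polynomial.eval_prod, Finset.prod_range_succ]
    simp only [Polynomial.eval_add, Polynomial.eval_mul, Polynomial.eval_X, Polynomial.eval_C,
      Polynomial.eval_one]
    ring
  have hn' : (n : ℂ) ≠ 0 := Nat.cast_ne_zero.2 hn.ne'
  refine mul_left_cancel₀ hn' ?_
  rw [mul_left_comm, h, h, ← Finset.prod_range_reflect]
  have hc : (-1 : ℂ) ^ (n + 1) = ∏ _k ∈ Finset.range (n + 1), (-1 : ℂ) := by simp
  rw [hc, ← Finset.prod_mul_distrib]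
  refine Finset.prod_congr rfl fun k hk => ?_
  rw [show n + 1 - 1 - k = n - k by omega,
    Nat.cast_sub (by have := Finset.mem_range.1 hk; omega)]
  ring

theorem coeff_act_leftD_picardFuchs_mul {n : ℕ} (hn : 0 < n) (N : ℕ) (f g : ℂ⟦X⟧) :
    coeff N (act (RingHom.id _) (opS (-N)) (leftD (picardFuchs n)) f * g) =
      (-1) ^ (n + 1) *
        coeff N (f * act (RingHom.id _) (opS 0) (leftD (picardFuchs n)) g) := by
  rw [leftD_picardFuchs, act_sub, act_sub, sub_mul, mul_sub, map_sub, map_sub, mul_sub]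
  simp only [act_C_mul, RingHom.id_apply]
  rw [mul_assoc, mul_left_comm f, coeff_C_mul, coeff_C_mul]
  congr 1
  · rw [coeff_act_map_mul N (-N) _ (Polynomial.C ((-1) ^ (n + 1)) * Polynomial.X ^ (n + 1))
      (fun b => by simp [← mul_pow]), Polynomial.map_mul, Polynomial.map_C, act_C_mul,
      RingHom.id_apply, mul_left_comm, coeff_C_mul]
  · rw [mul_assoc, mul_left_comm f, mul_left_comm ((-1) ^ (n + 1))]
    congr 1
    -- Multiplication by q lowers the paired degree by one while the twist stays -(N+1), whence the
    -- reflection b ↦ -1 - b.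
    cases N with
    | zero => simp
    | succ N =>
      rw [coeff_succ_X_mul, coeff_succ_X_mul,
        coeff_act_map_mul N _ _ (Polynomial.C ((-1) ^ (n + 1)) * shiftedProd n) (fun b => ?_),
        Polynomial.map_mul, Polynomial.map_C, act_C_mul,
        RingHom.id_apply, mul_left_comm, coeff_C_mul]
      rw [Polynomial.eval_mul, Polynomial.eval_C, ← eval_shiftedProd hn]
      congr 1; push_cast; ring

theorem act_opS_X_pow (p : Polynomial ℂ⟦X⟧) (d : ℕ) :
    act (RingHom.id _) (opS 0) p (X ^ d) = p.eval (C (d : ℂ)) * X ^ d := by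
  induction p using Polynomial.induction_on' with
  | add p r hp hr => rw [act_add, hp, hr, Polynomial.eval_add, add_mul]
  | monomial j b =>
    have h1 : qD (X ^ d : ℂ⟦X⟧) = C (d : ℂ) * X ^ d := by
      ext k
      rw [coeff_qD, coeff_C_mul, coeff_X_pow]
      split_ifs with hk
      · rw [hk]
      · simp
    have h : ∀ j, (opS 0 ^ j) (X ^ d) = C (d : ℂ) ^ j * X ^ d := by
      intro j
      induction j with
      | zero => simp
      | succ j ih =>
        rw [pow_succ', AddMonoid.End.coe_mul, Function.comp_apply, ih, opS_apply, ← map_pow,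
          qD_C_mul, h1, C.map_zero, map_pow, pow_succ]
        ring
    rw [act_monomial, h, Polynomial.eval_monomial, RingHom.id_apply, mul_assoc]

/-- On q^d an operator acts by its symbol evaluated at d, and infinitely many values determine a
polynomial. -/
theorem eq_of_act_opS_eq {p r : Polynomial ℂ⟦X⟧}
    (h : ∀ g, act (RingHom.id _) (opS 0) p g = act (RingHom.id _) (opS 0) r g) : p = r := by
  refine Polynomial.eq_of_infinite_eval_eq p r ?_
  refine (Set.infinite_range_of_injective
    (f := fun d : ℕ => (C (d : ℂ) : ℂ⟦X⟧)) fun a b hab => ?_).mono ?_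
  · exact_mod_cast C_injective hab
  · rintro _ ⟨d, rfl⟩
    have := h (X ^ d)
    rw [act_opS_X_pow, act_opS_X_pow] at this
    exact mul_right_cancel₀ (pow_ne_zero d X_ne_zero) this

/-- The reversed sequence of factors `1, C_n⁻¹, …, C_1⁻¹, 1`. -/
def revInv (n j : ℕ) : ℂ⟦X⟧ := if j = 0 then 1 else (Cser n (n + 1 - j))⁻¹

theorem constantCoeff_revInv (n j : ℕ) : constantCoeff (revInv n j) = 1 := by
  rw [revInv]
  split_ifs
  · simp
  · rw [constantCoeff_inv, constantCoeff_Cser, inv_one]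

theorem word_revInv {n : ℕ} (hn : 0 < n) :
    word (revInv n) (n + 1) = word (fun r => (Cser n r)⁻¹) (n + 1) := by
  have hw : word (fun r => (Cser n r)⁻¹) (n + 1) = leftD (picardFuchs n) := by
    rw [word, picardFuchs_eq hn]
  refine eq_of_act_opS_eq fun g => ?_
  ext N
  have h1 := coeff_act_word_mul N n (fun r => (Cser n r)⁻¹) (revInv n)
    (by simp [Cser_zero hn]) (by simp [revInv]) (fun j hj => by simp [revInv]) 1 g
  rw [hw, coeff_act_leftD_picardFuchs_mul hn, one_mul, one_mul] at h1
  rw [hw]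
  exact (mul_left_cancel₀ (pow_ne_zero _ (by norm_num)) h1).symm

/-- Inductively D kills each coefficient of w^j with j < k, so it is constant in q, and the row q =
0 shows that the constant is zero. -/
theorem X_pow_dvd_of_opW {F : ℂ⟦X⟧⟦X⟧} {k : ℕ} (h0 : X ^ k ∣ row 0 F)
    (h : (X : ℂ⟦X⟧⟦X⟧) ^ (k + 1) ∣ opW F) : (X : ℂ⟦X⟧⟦X⟧) ^ k ∣ F := by
  rw [X_pow_dvd_iff] at h0 h ⊢
  intro j hj
  have hq : qD (coeff j F) = 0 := by
    induction j with
    | zero => rw [← coeff_zero_opW]; exact h 0 (by omega)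
    | succ j ih =>
      have hF : coeff j F = 0 := by
        have hj' : j < k := by omega
        rw [eq_C_of_qD_eq_zero (ih hj')]
        simpa [row] using h0 j hj'
      have := h (j + 1) (by omega)
      rwa [coeff_succ_opW, hF, add_zero] at this
  rw [eq_C_of_qD_eq_zero hq]
  simpa [row] using h0 j hj

theorem revInv_eq {n : ℕ} (hn : 0 < n) {i : ℕ} (hi : i ≤ n) : revInv n i = (Cser n i)⁻¹ := by
  set G : ℕ → ℂ⟦X⟧⟦X⟧ := fun i => act C opW (word (revInv n) i) (E n) with hG
  have hsucc : ∀ i, G (i + 1) = opW (C (revInv n i) * G i) := fun i => act_word_succ opW_C_mul _ _ _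
  have hrow : ∀ i, row 0 (G i) = X ^ i := by
    intro i
    induction i with
    | zero => rw [hG]; simp only [word, act_one, row_E, ICoeff_zero, pow_zero]
    | succ i ih =>
      rw [hsucc, row_opW, row_zero_C_mul, constantCoeff_revInv, ih]
      simp [pow_succ']
  have hinv : ∀ i, revInv n i * (revInv n i)⁻¹ = 1 := fun i =>
    mul_inv_of_constantCoeff_eq_one (constantCoeff_revInv n i)
  -- Divisibility descends from the full word, which both sequences share. It then forces D(`revInv
  -- n i` · C_i) = 0, going up in i.
  have hdvd : ∀ j ≤ n + 1, X ^ (n + 1 - j) ∣ G (n + 1 - j) := by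
    intro j hj
    induction j with
    | zero =>
      have : G (n + 1) = X ^ (n + 1) * M^[n + 1] (E n) := by
        rw [hG]; simp only [word_revInv hn]; exact act_word_E n (n + 1)
      rw [Nat.sub_zero, this]
      exact dvd_mul_right _ _
    | succ j ih =>
      have ih' := ih (by omega)
      rw [show n + 1 - j = n - j + 1 by omega, hsucc] at ih'
      rw [Nat.add_sub_add_right]
      have h := X_pow_dvd_of_opW ?_ ih'
      · have h2 := h.mul_left (C (revInv n (n - j))⁻¹)
        rwa [← mul_assoc, ← map_mul, mul_comm _ (revInv n (n - j)), hinv, map_one, one_mul] at h2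
      · rw [row_zero_C_mul, hrow]; exact dvd_mul_left _ _
  have hC : ∀ i ≤ n, G i = X ^ i * M^[i] (E n) → revInv n i = (Cser n i)⁻¹ := by
    intro i hi hGi
    have hd := hdvd (n - i) (by omega)
    rw [show n + 1 - (n - i) = i + 1 by omega, hsucc, hGi, mul_left_comm, opW_X_pow_mul, pow_succ,
      mul_dvd_mul_iff_left (pow_ne_zero _ X_ne_zero), X_dvd_iff,
      ← coeff_zero_eq_constantCoeff_apply, coeff_zero_opW, coeff_C_mul,
      coeff_zero_eq_constantCoeff_apply] at hd
    have h1 := eq_C_of_qD_eq_zero hd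
    rw [map_mul] at h1
    have h2 : revInv n i * Cser n i = 1 := by
      rw [Cser, h1, constantCoeff_revInv]
      rw [show constantCoeff (constantCoeff (M^[i] (E n))) = 1 from constantCoeff_Cser n i]
      simp
    linear_combination (Cser n i)⁻¹ * h2 - revInv n i * Cser_mul_inv n i
  refine hC i hi ?_
  induction i with
  | zero => simp [hG, word, act_one]
  | succ i ih =>
    have ih' := ih (by omega)
    rw [hsucc, hC i (by omega) ih', ih', mul_left_comm, opW_X_pow_mul, Function.iterate_succ_apply',
      pow_succ, mul_assoc, X_mul_M _ (constantCoeff_Cser n i)]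
    rfl

/-- The symmetry `C_i = C_{n+1-i}`. -/
theorem Cser_symm {n i : ℕ} (hi : 1 ≤ i) (hin : i ≤ n) : Cser n (n + 1 - i) = Cser n i := by
  have h := revInv_eq (by omega : 0 < n) hin
  rw [revInv, if_neg (by omega)] at h
  linear_combination -(Cser n (n + 1 - i) * Cser n i) * h -
    Cser n (n + 1 - i) * Cser_mul_inv n i + Cser n i * Cser_mul_inv n (n + 1 - i)

/-! ### The series `A_i` -/

theorem Xser_zero {n : ℕ} (hn : 0 < n) : Xser n 0 = 0 := by
  rw [Xser, Cser_zero hn, qD_one, zero_mul]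

theorem L_mul_A (n i : ℕ) :
    L n * A n i = i * (qD (L n) * (L n)⁻¹) - ∑ r ∈ Finset.range (i + 1), Xser n r := by
  rw [A, ← mul_assoc, L_mul_inv, one_mul]

theorem L_ne_zero (n : ℕ) : L n ≠ 0 := ne_zero_of_constantCoeff_eq_one (constantCoeff_L n)

/-- The series `L^i / (C_0 ⋯ C_i)`. -/
def quot (n i : ℕ) : ℂ⟦X⟧ := L n ^ i * ∏ r ∈ Finset.range (i + 1), (Cser n r)⁻¹

theorem quot_zero (n : ℕ) : quot n 0 = (Cser n 0)⁻¹ := by simp [quot]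

theorem quot_succ (n i : ℕ) : quot n (i + 1) = quot n i * (L n * (Cser n (i + 1))⁻¹) := by
  rw [quot, quot, Finset.prod_range_succ _ (i + 1)]; ring

theorem quot_self {n : ℕ} (hn : 0 < n) : quot n n = 1 := by
  rw [quot, ← prod_Cser hn, ← Finset.prod_mul_distrib]
  exact Finset.prod_eq_one fun r _ => Cser_mul_inv n r

/-- This explains the shape of A_i: L A_i is the logarithmic derivative of `quot n i`. Conjugating D
by `quot n i` therefore gives D + L A_i, which turns words into `miura`. -/
theorem qD_quot {n : ℕ} (hn : 0 < n) (i : ℕ) : qD (quot n i) = L n * A n i * quot n i := by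
  induction i with
  | zero => simp [quot_zero, L_mul_A, Xser_zero hn, Cser_zero hn, qD_one]
  | succ i ih =>
    have h1 : L n * A n (i + 1) = L n * A n i + (qD (L n) * (L n)⁻¹) - Xser n (i + 1) := by
      rw [L_mul_A, L_mul_A, Finset.sum_range_succ _ (i + 1)]; push_cast; ring
    rw [quot_succ, qD_mul, ih, qD_mul, qD_inv (constantCoeff_Cser n _), h1, Xser]
    linear_combination -(quot n i * qD (L n) * (Cser n (i + 1))⁻¹) * L_mul_inv n

theorem A_self {n : ℕ} (hn : 0 < n) : A n n = 0 := by
  have h := qD_quot hn n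
  rw [quot_self hn, qD_one, mul_one] at h
  exact (mul_eq_zero.1 h.symm).resolve_left (L_ne_zero n)

theorem A_zero {n : ℕ} (hn : 0 < n) : A n 0 = 0 := by
  simp [A, Xser_zero hn]

/-- The symmetry `A_{n-i} = -A_i`. -/
theorem A_symm {n i : ℕ} (hn : 0 < n) (hi : i ≤ n) : A n (n - i) = -A n i := by
  have h0 := L_mul_A n n
  have h1 := L_mul_A n i
  have h2 := L_mul_A n (n - i)
  have h3 : ∑ k ∈ Finset.range (n - i), Xser n (i + 1 + k) =
      ∑ k ∈ Finset.range (n - i), Xser n (k + 1) := by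
    rw [← Finset.sum_range_reflect]
    refine Finset.sum_congr rfl fun k hk => ?_
    have hk := Finset.mem_range.1 hk
    rw [show i + 1 + (n - i - 1 - k) = n + 1 - (k + 1) by omega, Xser, Xser,
      Cser_symm (by omega) (by omega)]
  rw [A_self hn, mul_zero, show n + 1 = i + 1 + (n - i) by omega, Finset.sum_range_add, h3] at h0
  rw [Finset.sum_range_succ', Xser_zero hn, Nat.cast_sub hi] at h2
  refine mul_left_cancel₀ (L_ne_zero n) ?_
  linear_combination h1 + h2 - h0

/-- The operator `(L⁻¹ D + A_{r-1}) ⋯ (L⁻¹ D + A_0)`. -/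
def miura (n : ℕ) : ℕ → Polynomial ℂ⟦X⟧
  | 0 => 1
  | r + 1 => Polynomial.C (L n)⁻¹ * leftD (miura n r) + Polynomial.C (A n r) * miura n r

theorem C_mul_word_eq {n : ℕ} (hn : 0 < n) (i : ℕ) :
    Polynomial.C (Cser n i)⁻¹ * word (fun r => (Cser n r)⁻¹) i =
      Polynomial.C (quot n i) * miura n i := by
  induction i with
  | zero => simp [word, miura, quot_zero]
  | succ i ih =>
    have hL : Polynomial.C (L n) * Polynomial.C (L n)⁻¹ = 1 := by
      rw [← Polynomial.C_mul, L_mul_inv, Polynomial.C_1]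
    rw [word, ih, miura, leftD_C_mul, qD_quot hn, quot_succ]
    simp only [Polynomial.C_mul]
    linear_combination -(Polynomial.C (quot n i) * Polynomial.C (Cser n (i + 1))⁻¹ *
      leftD (miura n i)) * hL

theorem picardFuchs_eq_miura {n : ℕ} (hn : 0 < n) : picardFuchs n = miura n n := by
  rw [picardFuchs_eq hn, C_mul_word_eq hn, quot_self hn, Polynomial.C_1, one_mul]

/-! ### The filtration by the order of derivatives -/

/-- The algebra generated over `ℂ[L^{±1}]` by the `D^j A_i` with `j < l`. -/
def filt (n l : ℕ) : Subalgebra ℂ ℂ⟦X⟧ :=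
  Algebra.adjoin ℂ ({L n, (L n)⁻¹} ∪ {f | ∃ i j : ℕ, i < n ∧ j < l ∧ f = qD^[j] (A n i)})

theorem filt_mono (n : ℕ) {k l : ℕ} (h : k ≤ l) : filt n k ≤ filt n l := by
  refine Algebra.adjoin_mono (Set.union_subset_union_right _ ?_)
  rintro _ ⟨i, j, hi, hj, rfl⟩
  exact ⟨i, j, hi, by omega, rfl⟩

theorem L_mem_filt (n l : ℕ) : L n ∈ filt n l := Algebra.subset_adjoin (by simp)

theorem L_inv_mem_filt (n l : ℕ) : (L n)⁻¹ ∈ filt n l := Algebra.subset_adjoin (by simp)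

theorem iterate_qD_A_mem_filt {n l i j : ℕ} (hi : i < n) (hj : j < l) :
    qD^[j] (A n i) ∈ filt n l := Algebra.subset_adjoin (Or.inr ⟨i, j, hi, hj, rfl⟩)

theorem C_mem_filt (n l : ℕ) (a : ℂ) : (C a : ℂ⟦X⟧) ∈ filt n l := (filt n l).algebraMap_mem a

theorem qD_L_mem_filt {n : ℕ} (hn : 0 < n) (l : ℕ) : qD (L n) ∈ filt n l := by
  have hn' : (n : ℂ) ≠ 0 := Nat.cast_ne_zero.2 hn.ne'
  have h : qD (L n) = C ((n : ℂ)⁻¹) * (L n * (L n ^ n - 1)) := by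
    rw [← qD_L hn, ← map_natCast (C (R := ℂ)), ← mul_assoc, ← map_mul, inv_mul_cancel₀ hn', map_one,
      one_mul]
  rw [h]
  exact mul_mem (C_mem_filt n l _) (mul_mem (L_mem_filt n l)
    (sub_mem (pow_mem (L_mem_filt n l) n) (one_mem _)))

theorem qD_mem_filt {n : ℕ} (hn : 0 < n) {l : ℕ} {f : ℂ⟦X⟧} (hf : f ∈ filt n l) :
    qD f ∈ filt n (l + 1) := by
  have hle := filt_mono n (Nat.le_succ l)
  induction hf using Algebra.adjoin_induction with
  | mem f hf =>
    rcases hf with (rfl | rfl) | ⟨i, j, hi, hj, rfl⟩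
    · exact qD_L_mem_filt hn _
    · rw [qD_inv (constantCoeff_L n)]
      exact neg_mem (mul_mem (mul_mem (qD_L_mem_filt hn _) (L_inv_mem_filt n _))
        (L_inv_mem_filt n _))
    · rw [← Function.iterate_succ_apply' qD]
      exact iterate_qD_A_mem_filt hi (by omega)
  | algebraMap a =>
    rw [show algebraMap ℂ ℂ⟦X⟧ a = C a from rfl, qD_C]
    exact zero_mem _
  | add f g _ _ ihf ihg => rw [qD_add]; exact add_mem ihf ihg
  | mul f g hf hg ihf ihg =>
    rw [qD_mul]; exact add_mem (mul_mem ihf (hle hg)) (mul_mem (hle hf) ihg)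

/-- By the equation for D L, the ring ℂ[L^{±1}] is stable under D, so differentiating powers of L⁻¹
does not raise the filtration. -/
theorem qD_mem_filt_zero {n : ℕ} (hn : 0 < n) {f : ℂ⟦X⟧} (hf : f ∈ filt n 0) :
    qD f ∈ filt n 0 := by
  induction hf using Algebra.adjoin_induction with
  | mem f hf =>
    rcases hf with (rfl | rfl) | ⟨i, j, hi, hj, rfl⟩
    · exact qD_L_mem_filt hn _
    · rw [qD_inv (constantCoeff_L n)]
      exact neg_mem (mul_mem (mul_mem (qD_L_mem_filt hn _) (L_inv_mem_filt n _))
        (L_inv_mem_filt n _))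
    · omega
  | algebraMap a =>
    rw [show algebraMap ℂ ℂ⟦X⟧ a = C a from rfl, qD_C]
    exact zero_mem _
  | add f g _ _ ihf ihg => rw [qD_add]; exact add_mem ihf ihg
  | mul f g hf hg ihf ihg =>
    rw [qD_mul]; exact add_mem (mul_mem ihf hg) (mul_mem hf ihg)

/-! ### Linear relations between derivatives of equal order -/

/-- The linear part of the coefficient of `D^{r-1-k}` in `miura n r`, up to a power of `L`. -/
def linPart (n r k : ℕ) : ℂ⟦X⟧ :=
  ∑ i ∈ Finset.range r, ((r - 1 - i).choose k : ℂ⟦X⟧) * qD^[k] (A n i)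

theorem qD_linPart (n r k : ℕ) :
    qD (linPart n r k) =
      ∑ i ∈ Finset.range r, ((r - 1 - i).choose k : ℂ⟦X⟧) * qD^[k + 1] (A n i) := by
  rw [linPart, qD_sum]
  refine Finset.sum_congr rfl fun i _ => ?_
  rw [qD_mul, qD_natCast, zero_mul, zero_add, Function.iterate_succ_apply']

theorem linPart_mem_filt {n r : ℕ} (hr : r ≤ n) {k l : ℕ} (hk : k < l) :
    linPart n r k ∈ filt n l := by
  refine sum_mem fun i hi => mul_mem (natCast_mem _ _) (iterate_qD_A_mem_filt ?_ hk)
  have := Finset.mem_range.1 hi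
  omega

theorem linPart_succ_succ (n r k : ℕ) :
    linPart n (r + 1) (k + 1) = linPart n r (k + 1) + qD (linPart n r k) := by
  rw [qD_linPart, linPart, linPart, Finset.sum_range_succ, ← Finset.sum_add_distrib]
  simp only [Nat.add_sub_cancel, Nat.sub_self, Nat.choose_zero_succ, Nat.cast_zero, zero_mul,
    add_zero]
  refine Finset.sum_congr rfl fun i hi => ?_
  have hi := Finset.mem_range.1 hi
  rw [show r - i = r - 1 - i + 1 by omega, Nat.choose_succ_succ]
  push_cast; ring

theorem linPart_succ_zero (n r : ℕ) : linPart n (r + 1) 0 = linPart n r 0 + A n r := by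
  simp [linPart, Finset.sum_range_succ]

theorem linPart_eq_zero (n : ℕ) {r k : ℕ} (h : r ≤ k) : linPart n r k = 0 := by
  refine Finset.sum_eq_zero fun i hi => ?_
  have hi := Finset.mem_range.1 hi
  rw [Nat.choose_eq_zero_of_lt (by omega)]; simp

theorem coeff_miura_succ_zero (n r : ℕ) :
    (miura n (r + 1)).coeff 0 =
      (L n)⁻¹ * qD ((miura n r).coeff 0) + A n r * (miura n r).coeff 0 := by
  rw [miura, Polynomial.coeff_add, Polynomial.coeff_C_mul, Polynomial.coeff_C_mul, coeff_leftD_zero]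

theorem coeff_miura_succ_succ (n r j : ℕ) :
    (miura n (r + 1)).coeff (j + 1) =
      (L n)⁻¹ * ((miura n r).coeff j + qD ((miura n r).coeff (j + 1))) +
        A n r * (miura n r).coeff (j + 1) := by
  rw [miura, Polynomial.coeff_add, Polynomial.coeff_C_mul, Polynomial.coeff_C_mul, coeff_leftD_succ]

theorem coeff_miura_of_lt (n : ℕ) {r j : ℕ} (h : r < j) : (miura n r).coeff j = 0 := by
  induction r generalizing j with
  | zero => rw [miura, Polynomial.coeff_one, if_neg (by omega)]
  | succ r ih =>
    obtain ⟨j, rfl⟩ : ∃ k, j = k + 1 := ⟨j - 1, by omega⟩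
    rw [coeff_miura_succ_succ, ih (by omega), ih (by omega), qD_zero]; simp

theorem coeff_miura_self (n r : ℕ) : (miura n r).coeff r = (L n)⁻¹ ^ r := by
  induction r with
  | zero => simp [miura]
  | succ r ih =>
    rw [coeff_miura_succ_succ, ih, coeff_miura_of_lt n (Nat.lt_succ_self r), qD_zero, pow_succ]
    ring

/-- Of the r + 1 factors, j leave a D in the symbol; the other k + 1 either supply an A or
differentiate something. Order k on an A is reached only with a single A_i hit by all k derivatives,
chosen among the r - i factors to its left. The recursion for these counts is Pascal's rule,
`linPart_succ_succ`. -/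
theorem coeff_miura_sub_mem {n : ℕ} (hn : 0 < n) (r : ℕ) (hr : r + 1 ≤ n) (j k : ℕ)
    (h : j + k = r) :
    (miura n (r + 1)).coeff j - (L n)⁻¹ ^ r * linPart n (r + 1) k ∈ filt n k := by
  have hLp : ∀ l r, (L n)⁻¹ ^ r ∈ filt n l := fun l r => pow_mem (L_inv_mem_filt n l) r
  have hDL : ∀ l r, qD ((L n)⁻¹ ^ r) ∈ filt n l := fun l r =>
    filt_mono n l.zero_le (qD_mem_filt_zero hn (hLp 0 r))
  induction r generalizing j k with
  | zero =>
    obtain ⟨rfl, rfl⟩ : j = 0 ∧ k = 0 := by omega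
    rw [coeff_miura_succ_zero, linPart_succ_zero, linPart_eq_zero n le_rfl]
    simp [miura, qD_one]
  | succ r ih =>
    have ih := ih (by omega)
    cases k with
    | zero =>
      obtain rfl : j = r + 1 := by omega
      have h1 := ih r 0 (by omega)
      rw [coeff_miura_succ_succ, coeff_miura_self, linPart_succ_zero]
      have h2 := mul_mem (L_inv_mem_filt n 0) (add_mem h1 (hDL 0 (r + 1)))
      convert h2 using 1
      ring
    | succ k =>
      have h1 := ih j k (by omega)
      set b := (miura n (r + 1)).coeff j - (L n)⁻¹ ^ r * linPart n (r + 1) k with hb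
      have hcoeff : (miura n (r + 1)).coeff j = b + (L n)⁻¹ ^ r * linPart n (r + 1) k := by
        rw [hb]; ring
      have hlin : linPart n (r + 1) k ∈ filt n (k + 1) := linPart_mem_filt (by omega) (by omega)
      have h2 : A n (r + 1) * (miura n (r + 1)).coeff j ∈ filt n (k + 1) := by
        rw [hcoeff]
        refine mul_mem (iterate_qD_A_mem_filt (j := 0) (by omega) (by omega)) (add_mem
          (filt_mono n k.le_succ h1) (mul_mem (hLp _ _) hlin))
      have h3 : qD ((miura n (r + 1)).coeff j) - (L n)⁻¹ ^ r * qD (linPart n (r + 1) k) ∈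
          filt n (k + 1) := by
        rw [hcoeff, qD_add, qD_mul]
        convert add_mem (qD_mem_filt hn h1) (mul_mem (hDL (k + 1) r) hlin) using 1
        ring
      rw [linPart_succ_succ]
      cases j with
      | zero =>
        rw [coeff_miura_succ_zero, linPart_eq_zero n (by omega : r + 1 ≤ k + 1)]
        convert add_mem (mul_mem (L_inv_mem_filt n (k + 1)) h3) h2 using 1
        ring
      | succ j =>
        have h4 := ih j (k + 1) (by omega)
        rw [coeff_miura_succ_succ]
        convert add_mem (mul_mem (L_inv_mem_filt n (k + 1)) (add_mem h4 h3)) h2 using 1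
        ring

theorem X_mem_filt {n : ℕ} (hn : 0 < n) (l : ℕ) : (X : ℂ⟦X⟧) ∈ filt n l := by
  have h := L_pow_mul hn
  have hn' : (-(n : ℂ)) ^ n ≠ 0 := pow_ne_zero _ (neg_ne_zero.2 (Nat.cast_ne_zero.2 hn.ne'))
  have h1 : (C ((-(n : ℂ)) ^ n) : ℂ⟦X⟧) * X = 1 - (L n)⁻¹ ^ n := by
    have h2 : (L n)⁻¹ ^ n * L n ^ n = 1 := by rw [← mul_pow, mul_comm, L_mul_inv, one_pow]
    linear_combination (1 - C ((-(n : ℂ)) ^ n) * X) * h2 - (L n)⁻¹ ^ n * h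
  have h3 : (X : ℂ⟦X⟧) = C (((-(n : ℂ)) ^ n)⁻¹) * (1 - (L n)⁻¹ ^ n) := by
    rw [← h1, ← mul_assoc, ← map_mul, inv_mul_cancel₀ hn', map_one, one_mul]
  rw [h3]
  exact mul_mem (C_mem_filt n l _) (sub_mem (one_mem _) (pow_mem (L_inv_mem_filt n l) n))

theorem coeff_picardFuchs_mem {n : ℕ} (hn : 0 < n) (j : ℕ) : (picardFuchs n).coeff j ∈ filt n 0 := by
  rw [picardFuchs, Polynomial.coeff_sub, Polynomial.coeff_C_mul, Polynomial.coeff_C_mul,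
    Polynomial.coeff_map, Polynomial.coeff_map]
  exact sub_mem (C_mem_filt n 0 _)
    (mul_mem (C_mem_filt n 0 _) (mul_mem (X_mem_filt hn 0) (C_mem_filt n 0 _)))

theorem linPart_self_mem {n : ℕ} (hn : 0 < n) (k : ℕ) : linPart n n k ∈ filt n k := by
  rcases le_or_gt n k with hk | hk
  · rw [linPart_eq_zero n hk]; exact zero_mem _
  · obtain ⟨r, rfl⟩ : ∃ r, n = r + 1 := ⟨n - 1, by omega⟩
    have h1 := coeff_miura_sub_mem hn r le_rfl (r - k) k (by omega)
    rw [← picardFuchs_eq_miura hn] at h1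
    have h2 := sub_mem (filt_mono _ k.zero_le (coeff_picardFuchs_mem hn (r - k))) h1
    rw [sub_sub_cancel] at h2
    have h3 := mul_mem (pow_mem (L_mem_filt (r + 1) k) r) h2
    rwa [← mul_assoc, ← mul_pow, L_mul_inv, one_pow, one_mul] at h3

theorem sum_choose_mul_mem {n : ℕ} (hn : 0 < n) {k t : ℕ} (h : k ≤ t) :
    ∑ i ∈ Finset.range n, ((n - 1 - i).choose k : ℂ⟦X⟧) * qD^[t] (A n i) ∈ filt n t := by
  induction t, h using Nat.le_induction with
  | base => exact linPart_self_mem hn k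
  | succ t _ ih =>
    convert qD_mem_filt hn ih using 1
    rw [qD_sum]
    refine Finset.sum_congr rfl fun i _ => ?_
    rw [qD_mul, qD_natCast, zero_mul, zero_add, Function.iterate_succ_apply']

/-- A Newton expansion: polynomials are combinations of binomial coefficients. -/
theorem exists_eval_eq_sum_choose (f : Polynomial ℂ) {t : ℕ} (hf : f.natDegree ≤ t) :
    ∃ c : ℕ → ℂ, ∀ y : ℕ, f.eval (y : ℂ) = ∑ k ∈ Finset.range (t + 1), (y.choose k : ℂ) * c k := by
  refine ⟨fun k => (fwdDiff 1)^[k] f.eval 0, fun y => ?_⟩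
  have h := shift_eq_sum_fwdDiff_iter (1 : ℂ) f.eval y 0
  rw [zero_add, nsmul_one] at h
  rw [h]
  simp only [nsmul_eq_mul]
  have h1 : ∑ k ∈ Finset.range (y + 1), (y.choose k : ℂ) * (fwdDiff 1)^[k] f.eval 0 =
      ∑ k ∈ Finset.range (y + t + 1), (y.choose k : ℂ) * (fwdDiff 1)^[k] f.eval 0 := by
    refine Finset.sum_subset (Finset.range_mono (by omega)) fun k _ hk => ?_
    rw [Nat.choose_eq_zero_of_lt (by simpa using hk)]; simp
  rw [h1]
  refine (Finset.sum_subset (Finset.range_mono (by omega)) fun k _ hk => ?_).symm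
  rw [Polynomial.fwdDiff_iter_eq_zero_of_degree_lt (by simp at hk; omega)]; simp

theorem sum_eval_mul_mem {n : ℕ} (hn : 0 < n) (f : Polynomial ℂ) {t : ℕ} (hf : f.natDegree ≤ t) :
    ∑ i ∈ Finset.range n, C (f.eval (i : ℂ)) * qD^[t] (A n i) ∈ filt n t := by
  -- The relations involve binomials in n - 1 - i, hence the substitution x ↦ n - 1 - x.
  obtain ⟨c, hc⟩ := exists_eval_eq_sum_choose
    (f.comp (Polynomial.C ((n : ℂ) - 1) - Polynomial.X)) (t := t) (by
      refine Polynomial.natDegree_comp_le.trans ?_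
      have : (Polynomial.C ((n : ℂ) - 1) - Polynomial.X).natDegree ≤ 1 :=
        (Polynomial.natDegree_sub_le _ _).trans
          (by rw [Polynomial.natDegree_C, Polynomial.natDegree_X]; simp)
      nlinarith)
  have h : ∑ i ∈ Finset.range n, C (f.eval (i : ℂ)) * qD^[t] (A n i) =
      ∑ k ∈ Finset.range (t + 1), C (c k) *
        ∑ i ∈ Finset.range n, ((n - 1 - i).choose k : ℂ⟦X⟧) * qD^[t] (A n i) := by
    simp only [Finset.mul_sum]
    rw [Finset.sum_comm]
    refine Finset.sum_congr rfl fun i hi => ?_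
    have hi := Finset.mem_range.1 hi
    have h1 := hc (n - 1 - i)
    rw [Polynomial.eval_comp, Nat.sub_sub, Nat.cast_sub (by omega)] at h1
    have h2 : (Polynomial.C ((n : ℂ) - 1) - Polynomial.X).eval ((n : ℂ) - ((1 + i : ℕ) : ℂ)) =
        (i : ℂ) := by
      rw [Polynomial.eval_sub, Polynomial.eval_C, Polynomial.eval_X]; push_cast; ring
    rw [h2] at h1
    rw [h1, map_sum, Finset.sum_mul]
    refine Finset.sum_congr rfl fun k _ => ?_
    rw [map_mul, map_natCast, Nat.sub_sub]
    ring
  rw [h]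
  refine sum_mem fun k hk => mul_mem (C_mem_filt n t _) (sum_choose_mul_mem hn ?_)
  have := Finset.mem_range.1 hk
  omega

/-! ### Elimination -/

/-- The polynomial `(n/2 - x) ∏_{i < j ≤ m} ((n/2 - x)² - (n/2 - j)²)`, odd about `n/2`. -/
def oddPoly (n m i : ℕ) : Polynomial ℂ :=
  (Polynomial.C ((n : ℂ) / 2) - Polynomial.X) * ∏ j ∈ Finset.Ioc i m,
    ((Polynomial.C ((n : ℂ) / 2) - Polynomial.X) ^ 2 - Polynomial.C (((n : ℂ) / 2 - j) ^ 2))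

theorem eval_oddPoly (n m i : ℕ) (x : ℂ) :
    (oddPoly n m i).eval x =
      ((n : ℂ) / 2 - x) * ∏ j ∈ Finset.Ioc i m, ((j - x) * (n - x - j)) := by
  rw [oddPoly, Polynomial.eval_mul, Polynomial.eval_prod]
  simp only [Polynomial.eval_sub, Polynomial.eval_pow, Polynomial.eval_C, Polynomial.eval_X]
  congr 1
  refine Finset.prod_congr rfl fun j _ => ?_
  ring

theorem natDegree_oddPoly_le (n m i : ℕ) : (oddPoly n m i).natDegree ≤ 2 * (m - i) + 1 := by
  have h1 : (Polynomial.C ((n : ℂ) / 2) - Polynomial.X).natDegree ≤ 1 :=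
    (Polynomial.natDegree_sub_le _ _).trans
      (by rw [Polynomial.natDegree_C, Polynomial.natDegree_X]; simp)
  refine Polynomial.natDegree_mul_le.trans ?_
  rw [add_comm (2 * (m - i))]
  refine add_le_add h1 ((Polynomial.natDegree_prod_le _ _).trans ?_)
  refine (Finset.sum_le_card_nsmul _ _ 2 fun j _ => ?_).trans ?_
  · refine (Polynomial.natDegree_sub_le _ _).trans (max_le ?_ ?_)
    · exact Polynomial.natDegree_pow_le.trans (by omega)
    · rw [Polynomial.natDegree_C]; exact Nat.zero_le 2
  · rw [Nat.card_Ioc, smul_eq_mul, mul_comm]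

theorem eval_oddPoly_reflect (n m i : ℕ) (x : ℂ) :
    (oddPoly n m i).eval (n - x) = -(oddPoly n m i).eval x := by
  rw [eval_oddPoly, eval_oddPoly, ← neg_mul]
  congr 1
  · ring
  · refine Finset.prod_congr rfl fun j _ => ?_
    ring

theorem eval_oddPoly_eq_zero {n m i j : ℕ} (hm : n ≤ 2 * m + 2) (hij : i < j) (hjn : i + j < n) :
    (oddPoly n m i).eval (j : ℂ) = 0 := by
  rw [eval_oddPoly]
  rcases le_or_gt j m with hj | hj
  · rw [Finset.prod_eq_zero (Finset.mem_Ioc.2 ⟨hij, hj⟩) (by ring), mul_zero]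
  · rcases le_or_gt (n - j) m with hj' | hj'
    · rw [Finset.prod_eq_zero (Finset.mem_Ioc.2 ⟨by omega, hj'⟩), mul_zero]
      rw [Nat.cast_sub (by omega)]; ring
    -- The centre, for n even: the linear factor n/2 - x vanishes.
    · have : n = 2 * j := by omega
      rw [this]; push_cast; ring

theorem eval_oddPoly_self_ne_zero {n m i : ℕ} (him : i ≤ m) (hm : 2 * m < n) :
    (oddPoly n m i).eval (i : ℂ) ≠ 0 := by
  rw [eval_oddPoly]
  refine mul_ne_zero (fun h => ?_) (Finset.prod_ne_zero_iff.2 fun j hj => mul_ne_zero ?_ ?_)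
  · have : (n : ℂ) = ((2 * i : ℕ) : ℂ) := by push_cast; linear_combination 2 * h
    have := Nat.cast_injective this
    omega
  · have hj := Finset.mem_Ioc.1 hj
    rw [sub_ne_zero]
    exact fun h => hj.1.ne' (Nat.cast_injective h)
  · have hj := Finset.mem_Ioc.1 hj
    intro h
    have : (n : ℂ) = ((i + j : ℕ) : ℂ) := by push_cast; linear_combination h
    have := Nat.cast_injective this
    omega

theorem iterate_qD_zero (t : ℕ) : qD^[t] 0 = 0 := Function.iterate_fixed qD_zero t

theorem iterate_qD_neg (t : ℕ) (f : ℂ⟦X⟧) : qD^[t] (-f) = -qD^[t] f := by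
  induction t with
  | zero => rfl
  | succ t ih => rw [Function.iterate_succ_apply', ih, qD_neg, Function.iterate_succ_apply']

/-- The algebra generated over `ℂ` by `L^{±1}` and `𝔖_n`. -/
def algS (n : ℕ) : Subalgebra ℂ ℂ⟦X⟧ := Algebra.adjoin ℂ ({L n, (L n)⁻¹} ∪ genS n)

theorem iterate_qD_symm {n i : ℕ} (hn : 0 < n) (hi : i ≤ n) (t : ℕ) :
    qD^[t] (A n (n - i)) = -qD^[t] (A n i) := by
  rw [A_symm hn hi, iterate_qD_neg]

theorem iterate_qD_A_mem_of_le_half {n : ℕ} (hn : 0 < n) (S : Subalgebra ℂ ℂ⟦X⟧) (t : ℕ)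
    (h : ∀ i, 1 ≤ i → i ≤ (n - 1) / 2 → qD^[t] (A n i) ∈ S) (i : ℕ) (hi : i < n) :
    qD^[t] (A n i) ∈ S := by
  rcases Nat.eq_zero_or_pos i with rfl | hi0
  · rw [A_zero hn, iterate_qD_zero]; exact zero_mem _
  · rcases le_or_gt i ((n - 1) / 2) with him | him
    · exact h i hi0 him
    · have hs := iterate_qD_symm hn hi.le t
      rcases le_or_gt (n - i) ((n - 1) / 2) with him' | him'
      · have := neg_mem (h (n - i) (by omega) him')
        rwa [hs, neg_neg] at this
      -- Here n = 2i, so D^t A_i equals its own negative.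
      · rw [show n - i = i by omega] at hs
        have h0 : qD^[t] (A n i) = 0 := by
          ext k
          exact self_eq_neg.1 ((congrArg (coeff k) hs).trans (map_neg _ _))
        rw [h0]; exact zero_mem _

theorem iterate_qD_A_mem_algS {n : ℕ} (hn : 3 ≤ n) (t : ℕ) :
    ∀ i, i < n → qD^[t] (A n i) ∈ algS n := by
  have hn0 : 0 < n := by omega
  induction t using Nat.strong_induction_on with
  | _ t iht =>
  have hfilt : filt n t ≤ algS n := by
    refine Algebra.adjoin_le (Set.union_subset ?_ ?_)
    · exact fun f hf => Algebra.subset_adjoin (Or.inl hf)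
    · rintro _ ⟨i, j, hi, hj, rfl⟩
      exact iht j hj i hi
  refine iterate_qD_A_mem_of_le_half hn0 (algS n) t fun i => ?_
  set m := (n - 1) / 2 with hm
  induction i using Nat.strong_induction_on with
  | _ i ihi =>
  intro hi1 him
  -- Beyond this bound t is at least the degree bound 2(m-i)+1 of `oddPoly n m i`; up to it D^t A_i
  -- is itself in 𝔖_n.
  rcases le_or_gt t (2 * (m - i)) with ht | ht
  · refine Algebra.subset_adjoin (Or.inr ?_)
    rcases him.eq_or_lt with rfl | him'
    · obtain rfl : t = 0 := by omega
      exact Or.inr rfl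
    · exact Or.inl ⟨i, t, hi1, him', by omega, rfl⟩
  · have hlow : ∀ j < i, qD^[t] (A n j) ∈ algS n := by
      intro j hj
      rcases Nat.eq_zero_or_pos j with rfl | hj0
      · rw [A_zero hn0, iterate_qD_zero]; exact zero_mem _
      · exact ihi j hj hj0 (by omega)
    have hsum := hfilt (sum_eval_mul_mem hn0 (oddPoly n m i)
      ((natDegree_oddPoly_le n m i).trans (by omega : _ ≤ t)))
    -- The terms i and n - i are isolated; they agree, both the polynomial and A being odd under i ↦
    -- n - i, so they add up instead of cancelling.
    rw [← Finset.add_sum_erase _ _ (Finset.mem_range.2 (by omega : i < n)),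
      ← Finset.add_sum_erase _ _ (Finset.mem_erase.2
        ⟨(by omega : n - i ≠ i), Finset.mem_range.2 (by omega : n - i < n)⟩), ← add_assoc] at hsum
    have hrest : ∑ j ∈ ((Finset.range n).erase i).erase (n - i),
        C ((oddPoly n m i).eval (j : ℂ)) * qD^[t] (A n j) ∈ algS n := by
      refine sum_mem fun j hj => ?_
      simp only [Finset.mem_erase, Finset.mem_range] at hj
      obtain ⟨hj1, hj2, hj3⟩ := hj
      rcases lt_trichotomy j i with hji | rfl | hji
      · exact mul_mem ((algS n).algebraMap_mem _) (hlow j hji)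
      · exact absurd rfl hj2
      · rcases lt_or_ge (i + j) n with hjn | hjn
        · rw [eval_oddPoly_eq_zero (by omega) hji hjn, map_zero, zero_mul]; exact zero_mem _
        · have h1 := neg_mem (hlow (n - j) (by omega))
          rw [iterate_qD_symm hn0 hj3.le, neg_neg] at h1
          exact mul_mem ((algS n).algebraMap_mem _) h1
    have h2 := (add_mem_cancel_right hrest).1 hsum
    rw [iterate_qD_symm hn0 (by omega : i ≤ n), Nat.cast_sub (by omega), eval_oddPoly_reflect,
      map_neg, neg_mul_neg] at h2
    have hne := eval_oddPoly_self_ne_zero him (by omega : 2 * m < n)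
    have h3 : qD^[t] (A n i) = C ((2 * (oddPoly n m i).eval (i : ℂ))⁻¹) *
        (C ((oddPoly n m i).eval (i : ℂ)) * qD^[t] (A n i) +
          C ((oddPoly n m i).eval (i : ℂ)) * qD^[t] (A n i)) := by
      rw [← two_mul, ← mul_assoc, ← mul_assoc, ← map_ofNat (C (R := ℂ)), ← map_mul, ← map_mul,
        mul_assoc, inv_mul_cancel₀ (mul_ne_zero two_ne_zero hne), map_one, one_mul]
    rw [h3]
    exact mul_mem ((algS n).algebraMap_mem _) h2

/-! ### Finiteness and generation over ℂ[L^{±1}] -/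

theorem finite_genS (n : ℕ) : (genS n).Finite := by
  refine Set.Finite.union ?_ (Set.finite_singleton _)
  refine ((Set.finite_lt_nat n).prod (Set.finite_lt_nat n)).image
    (fun p : ℕ × ℕ => qD^[p.2] (A n p.1)) |>.subset ?_
  rintro _ ⟨i, j, hi1, hi, hj, rfl⟩
  exact ⟨(i, j), ⟨(by omega : i < n), (by omega : j < n)⟩, rfl⟩

theorem genS_subset_ringDA {n : ℕ} (hn : 3 ≤ n) : genS n ⊆ ringDA n := by
  rintro f (⟨i, j, hi1, hi, hj, rfl⟩ | rfl)
  · exact Algebra.subset_adjoin ⟨i, j, hi1, by omega, rfl⟩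
  · exact Algebra.subset_adjoin ⟨(n - 1) / 2, 0, by omega, by omega, rfl⟩

theorem ringDA_le_adjoin_genS {n : ℕ} (hn : 3 ≤ n) :
    ringDA n ≤ Algebra.adjoin (ringL n) (genS n) := by
  refine Algebra.adjoin_le ?_
  rintro _ ⟨i, j, hi1, hi, rfl⟩
  have h1 : algS n ≤ (Algebra.adjoin (ringL n) (genS n)).restrictScalars ℂ := by
    refine Algebra.adjoin_le (Set.union_subset ?_ ?_)
    · intro f hf
      exact (Algebra.adjoin (ringL n) (genS n)).algebraMap_mem
        (⟨f, Algebra.subset_adjoin hf⟩ : ringL n)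
    · exact fun f hf => (Algebra.subset_adjoin hf : f ∈ Algebra.adjoin (ringL n) (genS n))
  exact h1 (iterate_qD_A_mem_algS hn j i (by omega))

end

end LocalProj

theorem proposition4p9 (n : ℕ) (hn : 3 ≤ n) :
    (LocalProj.genS n).Finite ∧
    ∃ π : MvPolynomial (LocalProj.genS n) (LocalProj.ringL n) →ₐ[LocalProj.ringL n]
        LocalProj.ringDA n,
      (∀ s : LocalProj.genS n, ((π (MvPolynomial.X s) : LocalProj.ringDA n) : PowerSeries ℂ) = s) ∧
      Function.Surjective π := by
  refine ⟨LocalProj.finite_genS n,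
    MvPolynomial.aeval fun s => ⟨s, LocalProj.genS_subset_ringDA hn s.2⟩,
    fun s => by rw [MvPolynomial.aeval_X], ?_⟩
  rintro ⟨f, hf⟩
  have h := LocalProj.ringDA_le_adjoin_genS hn hf
  rw [Algebra.adjoin_eq_range] at h
  obtain ⟨p, hp⟩ := h
  refine ⟨p, Subtype.ext ?_⟩
  change (LocalProj.ringDA n).val _ = f
  rw [← hp, ← AlgHom.comp_apply, MvPolynomial.comp_aeval]
  rfl
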